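/- Let $G$ be a finite simple graph and $k$ a positive integer. A $k$-odd graceful coloring of $G$ is a map $\lambda\colon V(G)\to\{1,\dots,k\}$ such that $\lambda(u)\neq\lambda(v)$ for every edge $uv$, the edge labels $\lambda'(uv)=|\lambda(u)-\lambda(v)|$ of any two distinct edges sharing an endpoint are different, and $\lambda'(uv)$ is odd for every edge $uv$. Let $\chi_{og}(G)$ denote the smallest positive integer $k$ such that $G$ has a $k$-odd graceful coloring (and $\chi_{og}(G)=\infty$ if there is none). For $m,n\ge 2$ and $1\le r\le n$, let $K_{m,n}-K_{1,r}$ be the graph obtained from the complete bipartite graph $K_{m,n}$ by deleting $r$ edges incident with one vertex of the part of size $m$; it is connected if and only if $r\le n-1$. **Theorem.** Let $m,n\ge 2$ and $1\le r\le n-1$ be integers. Then $$\chi_{og}(K_{m,n}-K_{1,r})=2m+2n-5$$ if one of the following holds for some positive integer $s$: - $(m,n)=(3,2s)$ and $2\le r\le 2s-1$; - $(m,n)=(2s+1,2s)$, $s\ge 2$ and $s\le r\le 2s-1$; - $(m,n)=(2s+1,2s)$, $r=s-1$, and $s\ge 5$ is odd. In all other cases, $\chi_{og}(K_{m,n}-K_{1,r})=2m+2n-4$.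 -/

import Mathlib

/-- The label that a vertex labeling `c` induces on an edge `uv`. -/
def edgeLabel {V : Type*} (c : V → ℤ) (u v : V) : ℤ := |c u - c v|

/-- A graceful `k`-coloring: labels in `{1, …, k}`, adjacent vertices get distinct labels, and
distinct edges that share an endpoint get distinct induced labels. -/
structure IsGracefulColoring {V : Type*} (G : SimpleGraph V) (k : ℕ) (c : V → ℤ) : Prop where
  mem_Icc : ∀ v, c v ∈ Set.Icc (1 : ℤ) k
  vertex_proper : ∀ u v, G.Adj u v → c u ≠ c v
  edge_proper : ∀ u v w, G.Adj u v → G.Adj u w → v ≠ w → edgeLabel c u v ≠ edgeLabel c u w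

/-- A `k`-odd graceful coloring: a graceful `k`-coloring all of whose edge labels are odd. -/
structure IsOddGracefulColoring {V : Type*} (G : SimpleGraph V) (k : ℕ) (c : V → ℤ) : Prop
    extends IsGracefulColoring G k c where
  odd_edge : ∀ u v, G.Adj u v → Odd (edgeLabel c u v)

/-- The odd graceful chromatic number `χ_og(G)`: the smallest positive integer `k` such that `G`
has a `k`-odd graceful coloring, and `⊤` if there is none. -/
noncomputable def oddGracefulChromaticNumber {V : Type*} (G : SimpleGraph V) : ℕ∞ :=
  sInf {x : ℕ∞ | ∃ k : ℕ, 0 < k ∧ (∃ c : V → ℤ, IsOddGracefulColoring G k c) ∧ x = (k : ℕ∞)}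

/-- `K_{m,n} - K_{1,r}`: the complete bipartite graph on `Fin m ⊕ Fin n` without the edges that
join the vertex `u` of the part of size `m` to the `r = R.card` vertices in the subset `R` of the
part of size `n`. -/
def nearCompleteBipartite {m n : ℕ} (u : Fin m) (R : Finset (Fin n)) :
    SimpleGraph (Fin m ⊕ Fin n) :=
  (completeBipartiteGraph (Fin m) (Fin n)).deleteEdges
    {e | ∃ w ∈ R, e = s(Sum.inl u, Sum.inr w)}

/-- The triples `(m, n, r)` in one of the three exceptional families. -/
def InExceptionalFamily (m n r : ℕ) : Prop :=
  (∃ s : ℕ, 1 ≤ s ∧ m = 3 ∧ n = 2 * s ∧ 2 ≤ r ∧ r ≤ 2 * s - 1) ∨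
  (∃ s : ℕ, 2 ≤ s ∧ m = 2 * s + 1 ∧ n = 2 * s ∧ s ≤ r ∧ r ≤ 2 * s - 1) ∨
  (∃ s : ℕ, 5 ≤ s ∧ Odd s ∧ m = 2 * s + 1 ∧ n = 2 * s ∧ r = s - 1)

/-!
Since the graph is connected, the labels of the two parts have opposite parities. Let `X` be the
set of labels of the part of `u` other than that of `u`, and `N` the set of labels of the other
part. Adjacent edges `vw`, `vw'` have different labels iff `w` and `w'` have different labels and
the label of `v` is not their midpoint. So `|X| = m - 1`, `|N| = n`, and no midpoint of two
elements of one set belongs to the other.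

*Lower bound.* Put `L = m + n - 2` and suppose that all labels lie in `[1, 2L - 1]`. A midpoint of
two elements of one of the two sets has the parity of the other set exactly if these elements lie
in different classes modulo `4`. By the Cauchy-Davenport inequality in `ℤ`, a set `S` that meets
both classes therefore has at least `|S| - 1` such midpoints, all of which the other set has to
avoid. Counting the `L` odd and `L - 1` even labels then shows that the odd set `O` lies in one
class, the even set `E` meets two, and the midpoints of `E` and the elements of `O` partition the
odd labels. This is the equality case of Cauchy-Davenport. After rescaling, the two halves of `E`
become sets `A`, `B` with the same minimum `0` and maximum `M`, and `A + B` is both `A` followed by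
`M + B` and `B` followed by `M + A`. Hence `A = B` is `[0, M]` or its set of even elements, which
gives the two possibilities of `label_sets_classification`: `E` consists of all even labels and
`O = {1, 2L - 1}`, or `E` of the labels `≡ 2, 4` modulo `8` and `O` of those `≡ 1` modulo `4`. In
particular, `2L - 1 = 2m + 2n - 5` labels are always necessary.

It remains to fit in the label `z` of `u`. A vertex outside `R` may not be labeled by a midpoint of
`z` with an element of `X`, and of two labels symmetric about `z` one belongs to `R`. Counting the
vertices that are thus forced into `R` (`IsLabeling.two_le_card`, `IsLabeling.le_card_of_even`,
`IsLabeling.le_card_of_odd`) leaves exactly the exceptional families.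

*Upper bound.* In the exceptional families, the extremal label sets with `z = 3`, `7` or `11` do
attain these counts. In general `2m + 2n - 4` labels suffice: take `X = {1, 3, …, 2m - 3}`,
`z = 2m - 1`, `N = {2m - 2, 2m, …, 2m + 2n - 4}`, and give the label `2m - 2` to a vertex of `R`.
-/

open Finset Pointwise

/-! ### Sumsets of minimal size -/

/-- If `A` and `B` lie in `[0, M]`, `A` contains `M` and `B` contains `0`, then `A` followed by
`M + B` is contained in `A + B`. If the sumset is as small as possible, it has no other elements, so
that below `M` it coincides with `A` and above `M` with the translate of `B`. -/
lemma mem_of_mem_add_of_card_add_le {A B : Finset ℤ} {M : ℤ}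
    (hA : ∀ x ∈ A, 0 ≤ x ∧ x ≤ M) (hB : ∀ x ∈ B, 0 ≤ x ∧ x ≤ M)
    (hAM : M ∈ A) (hB₀ : 0 ∈ B) (hcard : (A + B).card + 1 ≤ A.card + B.card) :
    (∀ z ∈ A + B, z ≤ M → z ∈ A) ∧ ∀ z ∈ A + B, M ≤ z → z - M ∈ B := by
  have hsub : A ∪ B.image (M + ·) ⊆ A + B := by
    intro z hz
    rcases mem_union.1 hz with h | h
    · exact mem_add.2 ⟨z, h, 0, hB₀, by simp⟩
    · obtain ⟨b, hb, rfl⟩ := mem_image.1 h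
      exact add_mem_add hAM hb
  have hinter : A ∩ B.image (M + ·) ⊆ {M} := by
    intro z hz
    obtain ⟨h1, h2⟩ := mem_inter.1 hz
    obtain ⟨b, hb, rfl⟩ := mem_image.1 h2
    have := hA _ h1
    have := hB _ hb
    simp only [mem_singleton]
    omega
  have hinter' := card_le_card hinter
  have hun := card_union_add_card_inter A (B.image (M + ·))
  rw [card_image_of_injective _ (add_right_injective M)] at hun
  rw [card_singleton] at hinter'
  have heq := eq_of_subset_of_card_le hsub (by omega)
  constructor
  · intro z hz hzM
    rw [← heq] at hz
    rcases mem_union.1 hz with h | h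
    · exact h
    · obtain ⟨b, hb, rfl⟩ := mem_image.1 h
      have := hB _ hb
      have : b = 0 := by omega
      subst this
      simpa using hAM
  · intro z hz hzM
    rw [← heq] at hz
    rcases mem_union.1 hz with h | h
    · have := hA _ h
      have : z = M := by omega
      subst this
      simpa using hB₀
    · obtain ⟨b, hb, rfl⟩ := mem_image.1 h
      simpa using hb

/-- If `A` and `B` have minimum `0` and maximum `M`, the sumset `A + B` is as small as possible
and contains every even integer of `[0, 2M]`, then `A = B` is either the whole interval `[0, M]`
or the set of its even elements. -/
lemma mem_iff_of_card_add_le_of_even_mem_add {A B : Finset ℤ} {M : ℤ}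
    (hA : ∀ x ∈ A, 0 ≤ x ∧ x ≤ M) (hB : ∀ x ∈ B, 0 ≤ x ∧ x ≤ M)
    (hA₀ : 0 ∈ A) (hAM : M ∈ A) (hB₀ : 0 ∈ B) (hBM : M ∈ B)
    (hcard : (A + B).card + 1 ≤ A.card + B.card)
    (heven : ∀ z, 0 ≤ z → z ≤ 2 * M → z % 2 = 0 → z ∈ A + B) :
    A = B ∧ ((∀ x, x ∈ A ↔ 0 ≤ x ∧ x ≤ M) ∨
      (M % 2 = 0 ∧ ∀ x, x ∈ A ↔ 0 ≤ x ∧ x ≤ M ∧ x % 2 = 0)) := by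
  obtain ⟨h1, h2⟩ := mem_of_mem_add_of_card_add_le hA hB hAM hB₀ hcard
  obtain ⟨h3, -⟩ := mem_of_mem_add_of_card_add_le hB hA hBM hA₀
    (by rw [add_comm B A]; omega)
  have hAB : A = B := by
    ext x
    constructor
    · intro hx
      exact h3 x (mem_add.2 ⟨0, hB₀, x, hx, by simp⟩) (hA x hx).2
    · intro hx
      exact h1 x (mem_add.2 ⟨0, hA₀, x, hx, by simp⟩) (hB x hx).2
  subst hAB
  refine ⟨rfl, ?_⟩
  have hM := (hA M hAM).1
  have hev : ∀ x, 0 ≤ x → x ≤ M → x % 2 = 0 → x ∈ A := fun x hx0 hxM hx2 =>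
    h1 x (heven x hx0 (by omega) hx2) hxM
  by_cases hMp : M % 2 = 0
  · by_cases hodd : ∃ t ∈ A, t % 2 = 1
    · obtain ⟨t, ht, ht2⟩ := hodd
      have htM := hA t ht
      left
      refine fun x => ⟨hA x, fun hx => ?_⟩
      by_cases hx2 : x % 2 = 0
      · exact hev x hx.1 hx.2 hx2
      · -- an odd `x ≥ t` is `t` plus an even element of `A`; for an odd `x ≤ t` so is `M + x`
        rcases le_total t x with h | h
        · exact h1 x (mem_add.2 ⟨t, ht, x - t, hev _ (by omega) (by omega) (by omega),
            by omega⟩) hx.2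
        · have := h2 (M + x) (mem_add.2 ⟨t, ht, M + x - t,
            hev _ (by omega) (by omega) (by omega), by omega⟩) (by omega)
          simpa using this
    · right
      push Not at hodd
      refine ⟨hMp, fun x => ⟨fun hx => ⟨(hA x hx).1, (hA x hx).2, ?_⟩, fun hx =>
        hev x hx.1 hx.2.1 hx.2.2⟩⟩
      have := hodd x hx
      omega
  · left
    refine fun x => ⟨hA x, fun hx => ?_⟩
    by_cases hx2 : x % 2 = 0
    · exact hev x hx.1 hx.2 hx2
    · have := h2 (M + x) (heven _ (by omega) (by omega) (by omega)) (by omega)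
      simpa using this

/-! ### Midpoints and classes modulo four -/

/-- A finite set of integers that are `≡ c` modulo `4` and lie in `[c, c + 4k)` has at most `k`
elements, with equality only if it contains all of these integers. -/
lemma card_le_of_mod_four {S : Finset ℤ} {c : ℤ} {k : ℕ}
    (hS : ∀ x ∈ S, c ≤ x ∧ x < c + 4 * k ∧ (x - c) % 4 = 0) :
    S.card ≤ k ∧ (k ≤ S.card → ∀ x, c ≤ x → x < c + 4 * k → (x - c) % 4 = 0 → x ∈ S) := by
  set U : Finset ℤ := (range k).image (fun i : ℕ => c + 4 * (i : ℤ)) with hU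
  have hcardU : U.card = k := by
    rw [hU, card_image_of_injective, card_range]
    intro i j hij
    simp only at hij
    omega
  have hmem : ∀ x, c ≤ x → x < c + 4 * k → (x - c) % 4 = 0 → x ∈ U := by
    intro x h1 h2 h3
    refine mem_image.2 ⟨((x - c) / 4).toNat, mem_range.2 (by omega), by omega⟩
  have hsub : S ⊆ U := fun x hx => hmem x (hS x hx).1 (hS x hx).2.1 (hS x hx).2.2
  refine ⟨hcardU ▸ card_le_card hsub, fun hk x h1 h2 h3 => ?_⟩
  rw [eq_of_subset_of_card_le hsub (by omega)]
  exact hmem x h1 h2 h3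

/-- The elements of `S` that are congruent to `c` modulo `4`. -/
def modFour (S : Finset ℤ) (c : ℤ) : Finset ℤ := S.filter (fun x => x % 4 = c)

lemma mem_modFour {S : Finset ℤ} {c x : ℤ} : x ∈ modFour S c ↔ x ∈ S ∧ x % 4 = c := by
  simp [modFour]

lemma card_modFour_add {S : Finset ℤ} {c d : ℤ} (hcd : c ≠ d)
    (hS : ∀ x ∈ S, x % 4 = c ∨ x % 4 = d) :
    (modFour S c).card + (modFour S d).card = S.card := by
  rw [← card_union_of_disjoint]
  · congr 1
    ext x
    simp only [mem_union, mem_modFour]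
    constructor
    · rintro (h | h) <;> exact h.1
    · intro h
      rcases hS x h with h' | h'
      · exact Or.inl ⟨h, h'⟩
      · exact Or.inr ⟨h, h'⟩
  · rw [Finset.disjoint_left]
    intro x h1 h2
    exact hcd ((mem_modFour.1 h1).2.symm.trans (mem_modFour.1 h2).2)

/-- If a set `S` meets two classes modulo `4`, then the sums of an element of one class and an
element of the other (the doubled midpoints) number at least `|S| - 1`; they avoid the doubles
of the elements of any set `T` that contains no midpoint of two elements of `S`. -/
lemma card_le_card_doubled {S T : Finset ℤ} {c d : ℤ} (hcd : c ≠ d)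
    (hS : ∀ x ∈ S, x % 4 = c ∨ x % 4 = d)
    (hc : (modFour S c).Nonempty) (hd : (modFour S d).Nonempty)
    (hST : ∀ a ∈ S, ∀ b ∈ S, a ≠ b → ∀ t ∈ T, a + b ≠ 2 * t) :
    S.card + T.card ≤ (modFour S c + modFour S d ∪ T.image (2 * ·)).card + 1 ∧
      S.card ≤ (modFour S c + modFour S d).card + 1 ∧
      (modFour S c + modFour S d ∪ T.image (2 * ·)).card =
        (modFour S c + modFour S d).card + T.card := by
  have h1 := cauchy_davenport_add_of_linearOrder_isCancelAdd hc hd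
  have h2 := card_modFour_add hcd hS
  have h3 : (modFour S c + modFour S d ∪ T.image (2 * ·)).card =
        (modFour S c + modFour S d).card + T.card := by
    rw [card_union_of_disjoint, card_image_of_injective]
    · exact mul_right_injective₀ two_ne_zero
    · rw [Finset.disjoint_left]
      intro x hx hx'
      obtain ⟨a, ha, b, hb, rfl⟩ := mem_add.1 hx
      obtain ⟨t, ht, htx⟩ := mem_image.1 hx'
      rw [mem_modFour] at ha hb
      refine hST a ha.1 b hb.1 ?_ t ht htx.symm
      rintro rfl
      exact hcd (ha.2.symm.trans hb.2)
  omega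

/-- Two label sets `O` (odd) and `E` (even) in `[1, 2L - 1]` with `|O| + |E| = L + 1`, neither of
which contains a midpoint of two elements of the other, are one of two explicit pairs. -/
theorem label_sets_classification {L : ℕ} {O E : Finset ℤ} (hL : 2 ≤ L)
    (hO : ∀ x ∈ O, 1 ≤ x ∧ x ≤ 2 * L - 1 ∧ x % 2 = 1)
    (hE : ∀ x ∈ E, 1 ≤ x ∧ x ≤ 2 * L - 1 ∧ x % 2 = 0)
    (hcard : O.card + E.card = L + 1)
    (hOE : ∀ a ∈ O, ∀ b ∈ O, a ≠ b → ∀ e ∈ E, a + b ≠ 2 * e)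
    (hEO : ∀ a ∈ E, ∀ b ∈ E, a ≠ b → ∀ e ∈ O, a + b ≠ 2 * e) :
    (L % 2 = 1 ∧ O.card = 2 ∧ (∀ x, x ∈ O ↔ x = 1 ∨ x = 2 * L - 1) ∧
      ∀ x, x ∈ E ↔ 1 ≤ x ∧ x ≤ 2 * L - 1 ∧ x % 2 = 0) ∨
    (∃ s : ℕ, 1 ≤ s ∧ L = 4 * s - 1 ∧ O.card = 2 * s ∧
      (∀ x, x ∈ O ↔ 1 ≤ x ∧ x ≤ 8 * s - 3 ∧ x % 4 = 1) ∧
      ∀ x, x ∈ E ↔ 1 ≤ x ∧ x ≤ 8 * s - 3 ∧ (x % 8 = 2 ∨ x % 8 = 4)) := by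
  have hO4 : ∀ x ∈ O, x % 4 = 1 ∨ x % 4 = 3 := fun x hx => by have := hO x hx; omega
  have hE4 : ∀ x ∈ E, x % 4 = 2 ∨ x % 4 = 0 := fun x hx => by have := hE x hx; omega
  have hO13 := card_modFour_add (by norm_num) hO4
  have hE20 := card_modFour_add (by norm_num) hE4
  -- midpoints of a mixed `O` and the elements of `E` would not fit into the `L - 1` even labels
  have hOmono : modFour O 1 = ∅ ∨ modFour O 3 = ∅ := by
    by_contra! hne
    have h := (card_le_card_doubled (by norm_num) hO4 hne.1 hne.2 hOE).1
    have := (card_le_of_mod_four (c := 4) (k := L - 1)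
      (S := modFour O 1 + modFour O 3 ∪ E.image (2 * ·)) (by
        intro x hx
        rcases mem_union.1 hx with hx | hx
        · obtain ⟨a, ha, b, hb, rfl⟩ := mem_add.1 hx
          rw [mem_modFour] at ha hb
          have := hO a ha.1
          have := hO b hb.1
          omega
        · obtain ⟨a, ha, rfl⟩ := mem_image.1 hx
          have := hE a ha
          omega)).1
    omega
  have hO1le := (card_le_of_mod_four (c := 1) (k := (L + 1) / 2) (S := modFour O 1) (by
    intro x hx
    rw [mem_modFour] at hx
    have := hO x hx.1
    omega)).1
  have hO3le := (card_le_of_mod_four (c := 3) (k := L / 2) (S := modFour O 3) (by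
    intro x hx
    rw [mem_modFour] at hx
    have := hO x hx.1
    omega)).1
  have hE2le := (card_le_of_mod_four (c := 2) (k := L / 2) (S := modFour E 2) (by
    intro x hx
    rw [mem_modFour] at hx
    have := hE x hx.1
    omega)).1
  have hE0le := (card_le_of_mod_four (c := 4) (k := (L - 1) / 2) (S := modFour E 0) (by
    intro x hx
    rw [mem_modFour] at hx
    have := hE x hx.1
    omega)).1
  have hOle : O.card ≤ (L + 1) / 2 := by
    rcases hOmono with h | h <;> rw [h, card_empty] at hO13 <;> omega
  have hE2 : (modFour E 2).Nonempty := by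
    rw [nonempty_iff_ne_empty]
    intro h
    rw [h, card_empty] at hE20
    omega
  have hE0 : (modFour E 0).Nonempty := by
    rw [nonempty_iff_ne_empty]
    intro h
    rw [h, card_empty] at hE20
    omega
  -- midpoints of `E` and elements of `O` fill up the `L` odd labels
  obtain ⟨hcount, hmid, hunion⟩ := card_le_card_doubled (by norm_num) hE4 hE2 hE0 hEO
  obtain ⟨hle, hfull⟩ := card_le_of_mod_four (c := 2) (k := L)
      (S := modFour E 2 + modFour E 0 ∪ O.image (2 * ·)) (by
        intro x hx
        rcases mem_union.1 hx with hx | hx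
        · obtain ⟨a, ha, b, hb, rfl⟩ := mem_add.1 hx
          rw [mem_modFour] at ha hb
          have := hE a ha.1
          have := hE b hb.1
          omega
        · obtain ⟨a, ha, rfl⟩ := mem_image.1 hx
          have := hO a ha
          omega)
  have hdich : ∀ y : ℤ, 1 ≤ y → y ≤ 2 * L - 1 → y % 2 = 1 →
      (∃ a ∈ E, ∃ b ∈ E, a % 4 = 2 ∧ b % 4 = 0 ∧ a + b = 2 * y) ∨ y ∈ O := by
    intro y h1 h2 h3
    have := hfull (by omega) (2 * y) (by omega) (by omega) (by omega)
    rcases mem_union.1 this with h | h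
    · obtain ⟨a, ha, b, hb, hab⟩ := mem_add.1 h
      rw [mem_modFour] at ha hb
      exact Or.inl ⟨a, ha.1, b, hb.1, ha.2, hb.2, hab⟩
    · obtain ⟨z, hz, hzy⟩ := mem_image.1 h
      obtain rfl : z = y := by omega
      exact Or.inr hz
  have h1O : (1 : ℤ) ∈ O := by
    rcases hdich 1 (by omega) (by omega) (by omega) with ⟨a, ha, b, hb, h⟩ | h
    · have := hE a ha
      have := hE b hb
      omega
    · exact h
  have hkO : (2 * L - 1 : ℤ) ∈ O := by
    rcases hdich (2 * L - 1) (by omega) (by omega) (by omega) with ⟨a, ha, b, hb, h⟩ | h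
    · have := hE a ha
      have := hE b hb
      omega
    · exact h
  have hO1 : ∀ x ∈ O, x % 4 = 1 := by
    intro x hx
    rcases hOmono with h | h
    · have h1 : (1 : ℤ) ∈ modFour O 1 := mem_modFour.2 ⟨h1O, by norm_num⟩
      rw [h] at h1
      exact absurd h1 (notMem_empty _)
    · rcases hO4 x hx with h' | h'
      · exact h'
      · have h1 : x ∈ modFour O 3 := mem_modFour.2 ⟨hx, h'⟩
        rw [h] at h1
        exact absurd h1 (notMem_empty _)
  have hL2 := hO1 _ hkO
  obtain ⟨M, rfl⟩ : ∃ M : ℕ, L = 2 * M + 3 := ⟨(L - 3) / 2, by omega⟩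
  push_cast at *
  have hmid3 : ∀ y : ℤ, 1 ≤ y → y ≤ 2 * (2 * M + 3) - 1 → y % 4 = 3 →
      ∃ a ∈ E, ∃ b ∈ E, a % 4 = 2 ∧ b % 4 = 0 ∧ a + b = 2 * y := by
    intro y h1 h2 h3
    rcases hdich y h1 h2 (by omega) with h | h
    · exact h
    · have := hO1 y h
      omega
  have h24 : (2 : ℤ) ∈ E ∧ (4 : ℤ) ∈ E := by
    obtain ⟨a, ha, b, hb, ha4, hb4, h⟩ := hmid3 3 (by omega) (by omega) (by omega)
    have := hE a ha
    have := hE b hb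
    obtain rfl : a = 2 := by omega
    obtain rfl : b = 4 := by omega
    exact ⟨ha, hb⟩
  have hend : (2 + 4 * M : ℤ) ∈ E ∧ (4 + 4 * M : ℤ) ∈ E := by
    obtain ⟨a, ha, b, hb, ha4, hb4, h⟩ := hmid3 (4 * M + 3) (by omega) (by omega) (by omega)
    have := hE a ha
    have := hE b hb
    obtain rfl : a = 2 + 4 * M := by omega
    obtain rfl : b = 4 + 4 * M := by omega
    exact ⟨ha, hb⟩
  -- rescale the two classes of `E` to sets with minimum `0` and maximum `M`
  set A : Finset ℤ := (modFour E 2).image (fun x => (x - 2) / 4) with hAdef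
  set B : Finset ℤ := (modFour E 0).image (fun x => (x - 4) / 4) with hBdef
  have memA : ∀ i, i ∈ A ↔ 2 + 4 * i ∈ E := by
    intro i
    rw [hAdef, mem_image]
    constructor
    · rintro ⟨x, hx, rfl⟩
      rw [mem_modFour] at hx
      convert hx.1 using 1
      omega
    · intro h
      exact ⟨_, mem_modFour.2 ⟨h, by omega⟩, by omega⟩
  have memB : ∀ i, i ∈ B ↔ 4 + 4 * i ∈ E := by
    intro i
    rw [hBdef, mem_image]
    constructor
    · rintro ⟨x, hx, rfl⟩
      rw [mem_modFour] at hx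
      convert hx.1 using 1
      omega
    · intro h
      exact ⟨_, mem_modFour.2 ⟨h, by omega⟩, by omega⟩
  have cardA : A.card = (modFour E 2).card := card_image_of_injOn (by
    intro x hx y hy hxy
    have := (mem_modFour.1 hx).2
    have := (mem_modFour.1 hy).2
    simp only at hxy
    omega)
  have cardB : B.card = (modFour E 0).card := card_image_of_injOn (by
    intro x hx y hy hxy
    have := (mem_modFour.1 hx).2
    have := (mem_modFour.1 hy).2
    simp only at hxy
    omega)
  have cardAB : (A + B).card ≤ (modFour E 2 + modFour E 0).card := by
    rw [← card_image_of_injective (A + B) (f := fun x : ℤ => 6 + 4 * x)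
      (fun x y hxy => by simp only at hxy; omega)]
    refine card_le_card fun z hz => ?_
    obtain ⟨w, hw, rfl⟩ := mem_image.1 hz
    obtain ⟨a, ha, b, hb, rfl⟩ := mem_add.1 hw
    exact mem_add.2 ⟨2 + 4 * a, mem_modFour.2 ⟨(memA a).1 ha, by omega⟩, 4 + 4 * b,
      mem_modFour.2 ⟨(memB b).1 hb, by omega⟩, by ring⟩
  obtain ⟨hAB, hcases⟩ := mem_iff_of_card_add_le_of_even_mem_add (A := A) (B := B) (M := M)
    (fun x hx => by have := hE _ ((memA x).1 hx); omega)
    (fun x hx => by have := hE _ ((memB x).1 hx); omega)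
    ((memA 0).2 h24.1) ((memA M).2 hend.1) ((memB 0).2 h24.2) ((memB M).2 hend.2)
    (by omega) (by
      intro z hz0 hzM hz2
      obtain ⟨a, ha, b, hb, ha4, hb4, h⟩ := hmid3 (3 + 2 * z) (by omega) (by omega) (by omega)
      refine mem_add.2 ⟨(a - 2) / 4, (memA _).2 ?_, (b - 4) / 4, (memB _).2 ?_, by omega⟩
      · convert ha using 1
        omega
      · convert hb using 1
        omega)
  have hEA : ∀ x, x ∈ E ↔ (x % 4 = 2 ∧ (x - 2) / 4 ∈ A) ∨ (x % 4 = 0 ∧ (x - 4) / 4 ∈ A) := by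
    intro x
    constructor
    · intro hx
      rcases hE4 x hx with h | h
      · refine Or.inl ⟨h, (memA _).2 ?_⟩
        convert hx using 1
        omega
      · refine Or.inr ⟨h, hAB ▸ (memB _).2 ?_⟩
        convert hx using 1
        omega
    · rintro (⟨h, h'⟩ | ⟨h, h'⟩)
      · convert (memA _).1 h' using 1
        omega
      · rw [hAB] at h'
        convert (memB _).1 h' using 1
        omega
  rcases hcases with hall | ⟨hM2, heven⟩
  · left
    have hEall : ∀ x, x ∈ E ↔ 1 ≤ x ∧ x ≤ 2 * (2 * M + 3) - 1 ∧ x % 2 = 0 := by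
      intro x
      rw [hEA, hall, hall]
      omega
    have hOall : ∀ x, x ∈ O ↔ x = 1 ∨ x = 2 * (2 * M + 3) - 1 := by
      intro x
      constructor
      · -- any other odd label is the midpoint of its two neighbours, which are in `E`
        intro hx
        by_contra! hne
        have := hO x hx
        exact hEO (x - 1) ((hEall _).2 (by omega)) (x + 1) ((hEall _).2 (by omega)) (by omega)
          x hx (by omega)
      · rintro (rfl | rfl)
        · exact h1O
        · exact hkO
    refine ⟨by omega, ?_, hOall, hEall⟩
    have : O = {1, 2 * (2 * (M : ℤ) + 3) - 1} := by
      ext x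
      rw [hOall]
      simp
    rw [this, card_pair (by omega)]
  · right
    obtain ⟨t, rfl⟩ : ∃ t : ℕ, M = 2 * t := ⟨M / 2, by omega⟩
    have hEall : ∀ x, x ∈ E ↔ 1 ≤ x ∧ x ≤ 8 * t + 5 ∧ (x % 8 = 2 ∨ x % 8 = 4) := by
      intro x
      rw [hEA, heven, heven]
      omega
    have hOall : ∀ x, x ∈ O ↔ 1 ≤ x ∧ x ≤ 8 * t + 5 ∧ x % 4 = 1 := by
      intro x
      constructor
      · intro hx
        have := hO x hx
        have := hO1 x hx
        omega
      · rintro ⟨h1, h2, h3⟩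
        rcases hdich x h1 (by omega) (by omega) with ⟨a, ha, b, hb, ha4, hb4, h⟩ | h
        · have := (hEall a).1 ha
          have := (hEall b).1 hb
          omega
        · exact h
    refine ⟨t + 1, by omega, by omega, ?_, fun x => by rw [hOall]; push_cast; omega,
      fun x => by rw [hEall]; push_cast; omega⟩
    have hOimage : O = (range (2 * (t + 1))).image (fun i : ℕ => 1 + 4 * (i : ℤ)) := by
      ext x
      rw [hOall, mem_image]
      constructor
      · rintro ⟨h1, h2, h3⟩
        exact ⟨((x - 1) / 4).toNat, mem_range.2 (by omega), by omega⟩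
      · rintro ⟨i, hi, rfl⟩
        have := mem_range.1 hi
        omega
    rw [hOimage, card_image_of_injective _ (fun i j hij => by omega), card_range]

/-! ### Adjacency and edge labels -/

lemma oddGracefulChromaticNumber_eq {V : Type*} {G : SimpleGraph V} {k : ℕ} (hk : 0 < k)
    (hex : ∃ c : V → ℤ, IsOddGracefulColoring G k c)
    (hmin : ∀ (j : ℕ) (c : V → ℤ), IsOddGracefulColoring G j c → k ≤ j) :
    oddGracefulChromaticNumber G = (k : ℕ∞) := by
  apply le_antisymm
  · exact sInf_le ⟨k, hk, hex, rfl⟩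
  · refine le_sInf ?_
    rintro x ⟨j, -, ⟨c, hc⟩, rfl⟩
    exact_mod_cast hmin j c hc

section Graph

variable {m n : ℕ} {u : Fin m} {R : Finset (Fin n)}

lemma nearCompleteBipartite_adj_inl_inr {x : Fin m} {w : Fin n} :
    (nearCompleteBipartite u R).Adj (Sum.inl x) (Sum.inr w) ↔ (x = u → w ∉ R) := by
  simp only [nearCompleteBipartite, SimpleGraph.deleteEdges_adj, completeBipartiteGraph_adj]
  simp
  grind

lemma nearCompleteBipartite_adj_inr_inl {x : Fin m} {w : Fin n} :
    (nearCompleteBipartite u R).Adj (Sum.inr w) (Sum.inl x) ↔ (x = u → w ∉ R) := by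
  rw [SimpleGraph.adj_comm, nearCompleteBipartite_adj_inl_inr]

lemma nearCompleteBipartite_not_adj_inl_inl {x y : Fin m} :
    ¬ (nearCompleteBipartite u R).Adj (Sum.inl x) (Sum.inl y) := by
  simp [nearCompleteBipartite]

lemma nearCompleteBipartite_not_adj_inr_inr {x y : Fin n} :
    ¬ (nearCompleteBipartite u R).Adj (Sum.inr x) (Sum.inr y) := by
  simp [nearCompleteBipartite]

lemma edgeLabel_ne_iff {V : Type*} {c : V → ℤ} {v a b : V} :
    edgeLabel c v a ≠ edgeLabel c v b ↔ c a ≠ c b ∧ c a + c b ≠ 2 * c v := by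
  rw [edgeLabel, edgeLabel, Ne, abs_eq_abs]
  omega

/-! ### Constructions of colorings -/

/-- Sets of labels for the three parts of the graph determine a coloring: `C` labels the vertices
of the part of `u` other than `u`, `D` the other part, `z` the vertex `u`, and `F` the vertices of
`R`. It suffices that `F` has at most `r` elements, as enlarging `F` only weakens the
conditions. -/
theorem exists_isOddGracefulColoring {k : ℕ} {C D F : Finset ℤ} {z : ℤ}
    (hCcard : C.card + 1 = m) (hDcard : D.card = n) (hFD : F ⊆ D) (hF : F.card ≤ R.card)
    (hCk : ∀ a ∈ C, 1 ≤ a ∧ a ≤ k) (hDk : ∀ d ∈ D, 1 ≤ d ∧ d ≤ k) (hzk : 1 ≤ z ∧ z ≤ k)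
    (hzC : z ∉ C) (hCD : ∀ a ∈ C, ∀ d ∈ D, (a + d) % 2 = 1) (hzD : ∀ d ∈ D, (z + d) % 2 = 1)
    (hCC : ∀ a ∈ C, ∀ b ∈ C, a ≠ b → ∀ d ∈ D, a + b ≠ 2 * d)
    (hDD : ∀ d ∈ D, ∀ e ∈ D, d ≠ e → ∀ a ∈ C, d + e ≠ 2 * a)
    (hzmid : ∀ a ∈ C, ∀ d ∈ D, d ∉ F → a + z ≠ 2 * d)
    (hmidz : ∀ d ∈ D, d ∉ F → ∀ e ∈ D, e ∉ F → d ≠ e → d + e ≠ 2 * z) :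
    ∃ c : Fin m ⊕ Fin n → ℤ, IsOddGracefulColoring (nearCompleteBipartite u R) k c := by
  obtain ⟨F', hFF', hF'D, hF'card⟩ := exists_subsuperset_card_eq hFD hF
    (by rw [hDcard]; simpa using card_le_univ R)
  have e₁ : {x : Fin m // x ≠ u} ≃ C := Fintype.equivOfCardEq (by
    rw [Fintype.card_subtype_compl]; simp; omega)
  have e₂ : {w : Fin n // w ∈ R} ≃ F' := Fintype.equivOfCardEq (by simp [hF'card])
  have e₃ : {w : Fin n // w ∉ R} ≃ (D \ F' : Finset ℤ) := Fintype.equivOfCardEq (by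
    rw [Fintype.card_subtype_compl]; simp [card_sdiff_of_subset hF'D, hF'card, hDcard])
  let f : Fin m → ℤ := fun x => if h : x = u then z else e₁ ⟨x, h⟩
  let g : Fin n → ℤ := fun w => if h : w ∈ R then e₂ ⟨w, h⟩ else e₃ ⟨w, h⟩
  have hfu : f u = z := by simp [f]
  have hfC : ∀ x, x ≠ u → f x ∈ C := by
    intro x hx
    simp only [f, hx, dite_false]
    exact (e₁ _).2
  have hfne : ∀ x y, x ≠ y → f x ≠ f y := by
    intro x y hxy
    by_cases hx : x = u
    · subst hx
      rw [hfu]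
      exact fun h => hzC (h ▸ hfC y hxy.symm)
    · by_cases hy : y = u
      · subst hy
        rw [hfu]
        exact fun h => hzC (h ▸ hfC x hxy)
      · simp only [f, hx, hy, dite_false]
        intro h
        have := e₁.injective (Subtype.ext h)
        exact hxy (congrArg Subtype.val this)
  have hgR : ∀ w, w ∈ R → g w ∈ F' := by
    intro w hw
    simp only [g, hw, dite_true]
    exact (e₂ _).2
  have hgS : ∀ w, w ∉ R → g w ∈ D ∧ g w ∉ F' := by
    intro w hw
    simp only [g, hw, dite_false]
    exact mem_sdiff.1 (e₃ _).2
  have hgD : ∀ w, g w ∈ D := fun w => by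
    by_cases hw : w ∈ R
    · exact hF'D (hgR w hw)
    · exact (hgS w hw).1
  have hgne : ∀ w v, w ≠ v → g w ≠ g v := by
    intro w v hwv
    by_cases hw : w ∈ R <;> by_cases hv : v ∈ R
    · simp only [g, hw, hv, dite_true]
      intro h
      exact hwv (congrArg Subtype.val (e₂.injective (Subtype.ext h)))
    · exact fun h => (hgS v hv).2 (h ▸ hgR w hw)
    · exact fun h => (hgS w hw).2 (h ▸ hgR v hv)
    · simp only [g, hw, hv, dite_false]
      intro h
      exact hwv (congrArg Subtype.val (e₃.injective (Subtype.ext h)))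
  have hpar : ∀ x w, (f x + g w) % 2 = 1 := by
    intro x w
    by_cases hx : x = u
    · subst hx
      rw [hfu]
      exact hzD _ (hgD w)
    · exact hCD _ (hfC x hx) _ (hgD w)
  have hodd : ∀ a b : ℤ, (a + b) % 2 = 1 → Odd |a - b| := by
    intro a b h
    rw [odd_abs, Int.odd_iff]
    omega
  refine ⟨Sum.elim f g, ⟨⟨?_, ?_, ?_⟩, ?_⟩⟩
  · rintro (x | w)
    · by_cases hx : x = u
      · subst hx
        simpa [hfu] using hzk
      · exact hCk _ (hfC x hx)
    · exact hDk _ (hgD w)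
  · rintro (x | w) (y | v) hadj
    · exact absurd hadj nearCompleteBipartite_not_adj_inl_inl
    · have := hpar x v
      simp only [Sum.elim_inl, Sum.elim_inr]
      omega
    · have := hpar y w
      simp only [Sum.elim_inl, Sum.elim_inr]
      omega
    · exact absurd hadj nearCompleteBipartite_not_adj_inr_inr
  · rintro (x | w) (y | v) (y' | v') h1 h2 hne
    all_goals first
      | exact absurd h1 nearCompleteBipartite_not_adj_inl_inl
      | exact absurd h1 nearCompleteBipartite_not_adj_inr_inr
      | exact absurd h2 nearCompleteBipartite_not_adj_inl_inl
      | exact absurd h2 nearCompleteBipartite_not_adj_inr_inr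
      | skip
    · rw [nearCompleteBipartite_adj_inl_inr] at h1 h2
      have hvv : v ≠ v' := fun h => hne (congrArg _ h)
      rw [edgeLabel_ne_iff]
      refine ⟨hgne v v' hvv, ?_⟩
      simp only [Sum.elim_inl, Sum.elim_inr]
      by_cases hx : x = u
      · subst hx
        rw [hfu]
        exact hmidz _ (hgD v) (fun h => (hgS v (h1 rfl)).2 (hFF' h)) _ (hgD v')
          (fun h => (hgS v' (h2 rfl)).2 (hFF' h)) (hgne v v' hvv)
      · exact hDD _ (hgD v) _ (hgD v') (hgne v v' hvv) _ (hfC x hx)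
    · rw [nearCompleteBipartite_adj_inr_inl] at h1 h2
      have hyy : y ≠ y' := fun h => hne (congrArg _ h)
      rw [edgeLabel_ne_iff]
      refine ⟨hfne y y' hyy, ?_⟩
      simp only [Sum.elim_inl, Sum.elim_inr]
      by_cases hy : y = u
      · subst hy
        rw [hfu, add_comm]
        exact hzmid _ (hfC y' hyy.symm) _ (hgD w) (fun h => (hgS w (h1 rfl)).2 (hFF' h))
      · by_cases hy' : y' = u
        · subst hy'
          rw [hfu]
          exact hzmid _ (hfC y hy) _ (hgD w) (fun h => (hgS w (h2 rfl)).2 (hFF' h))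
        · exact hCC _ (hfC y hy) _ (hfC y' hy') (hfne y y' hyy) _ (hgD w)
  · rintro (x | w) (y | v) hadj
    · exact absurd hadj nearCompleteBipartite_not_adj_inl_inl
    · exact hodd _ _ (hpar x v)
    · exact hodd _ _ (by rw [add_comm]; exact hpar y w)
    · exact absurd hadj nearCompleteBipartite_not_adj_inr_inr

lemma exists_isOddGracefulColoring_of_one_le (hm : 2 ≤ m) (hn : 2 ≤ n) (hR : 1 ≤ R.card) :
    ∃ c : Fin m ⊕ Fin n → ℤ,
      IsOddGracefulColoring (nearCompleteBipartite u R) (2 * m + 2 * n - 4) c := by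
  have hC : ∀ a ∈ (range (m - 1)).image (fun i : ℕ => 2 * (i : ℤ) + 1),
      1 ≤ a ∧ a ≤ 2 * m - 3 ∧ a % 2 = 1 := by
    intro a ha
    obtain ⟨i, hi, rfl⟩ := mem_image.1 ha
    have := mem_range.1 hi
    omega
  have hD : ∀ d ∈ (range n).image (fun i : ℕ => 2 * (i : ℤ) + (2 * m - 2)),
      2 * m - 2 ≤ d ∧ d ≤ 2 * m + 2 * n - 4 ∧ d % 2 = 0 := by
    intro a ha
    obtain ⟨i, hi, rfl⟩ := mem_image.1 ha
    have := mem_range.1 hi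
    omega
  refine exists_isOddGracefulColoring
    (C := (range (m - 1)).image (fun i : ℕ => 2 * (i : ℤ) + 1))
    (D := (range n).image (fun i : ℕ => 2 * (i : ℤ) + (2 * m - 2)))
    (F := {(2 * m - 2 : ℤ)}) (z := 2 * m - 1) ?_ ?_ ?_ (by simpa using hR) ?_ ?_ (by omega) ?_
    ?_ ?_ ?_ ?_ ?_ ?_
  · rw [card_image_of_injective _ (fun i j hij => by omega), card_range]
    omega
  · rw [card_image_of_injective _ (fun i j hij => by omega), card_range]
  · intro x hx
    rw [mem_singleton] at hx
    exact mem_image.2 ⟨0, mem_range.2 (by omega), by simp [hx]⟩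
  · intro a ha
    have := hC a ha
    omega
  · intro d hd
    have := hD d hd
    omega
  · intro h
    have := hC _ h
    omega
  · intro a ha d hd
    have := hC a ha
    have := hD d hd
    omega
  · intro d hd
    have := hD d hd
    omega
  · intro a ha b hb hab d hd
    have := hC a ha
    have := hC b hb
    have := hD d hd
    omega
  · intro d hd e he hde a ha
    have := hC a ha
    have := hD d hd
    have := hD e he
    omega
  · intro a ha d hd hdF
    rw [mem_singleton] at hdF
    have := hC a ha
    have := hD d hd
    omega
  · intro d hd hdF e he heF hde
    rw [mem_singleton] at hdF heF
    have := hD d hd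
    have := hD e he
    omega

lemma exists_isOddGracefulColoring_three {s : ℕ} {u : Fin 3} {R : Finset (Fin (2 * s))}
    (hs : 2 ≤ s) (hR : 2 ≤ R.card) :
    ∃ c : Fin 3 ⊕ Fin (2 * s) → ℤ,
      IsOddGracefulColoring (nearCompleteBipartite u R) (4 * s + 1) c := by
  have hC : ∀ a ∈ ({1, (4 * s + 1 : ℤ)} : Finset ℤ), a = 1 ∨ a = 4 * s + 1 := by simp
  have hD : ∀ d ∈ (range (2 * s)).image (fun i : ℕ => 2 * (i : ℤ) + 2),
      2 ≤ d ∧ d ≤ 4 * s ∧ d % 2 = 0 := by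
    intro a ha
    obtain ⟨i, hi, rfl⟩ := mem_image.1 ha
    have := mem_range.1 hi
    omega
  refine exists_isOddGracefulColoring
    (C := {1, (4 * s + 1 : ℤ)})
    (D := (range (2 * s)).image (fun i : ℕ => 2 * (i : ℤ) + 2))
    (F := {2, (2 * s + 2 : ℤ)}) (z := 3) ?_ ?_ ?_ (card_le_two.trans hR) ?_ ?_
    ⟨by norm_num, by omega⟩ ?_ ?_ ?_ ?_ ?_ ?_ ?_
  · have hne : (1 : ℤ) ≠ 4 * s + 1 := by omega
    rw [card_pair hne]
  · rw [card_image_of_injective _ (fun i j hij => by omega), card_range]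
  · intro x hx
    rw [mem_insert, mem_singleton] at hx
    rcases hx with rfl | rfl
    · exact mem_image.2 ⟨0, mem_range.2 (by omega), by simp⟩
    · exact mem_image.2 ⟨s, mem_range.2 (by omega), by simp⟩
  · intro a ha
    have := hC a ha
    push_cast
    omega
  · intro d hd
    have := hD d hd
    push_cast
    omega
  · intro h
    have := hC _ h
    omega
  · intro a ha d hd
    have := hC a ha
    have := hD d hd
    omega
  · intro d hd
    have := hD d hd
    omega
  · intro a ha b hb hab d hd
    have := hC a ha
    have := hC b hb
    have := hD d hd
    omega
  · intro d hd e he hde a ha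
    have := hC a ha
    have := hD d hd
    have := hD e he
    omega
  · intro a ha d hd hdF
    rw [mem_insert, mem_singleton] at hdF
    have := hC a ha
    have := hD d hd
    omega
  · intro d hd hdF e he heF hde
    rw [mem_insert, mem_singleton] at hdF heF
    have := hD d hd
    have := hD e he
    omega

/-- The coloring with labels `≡ 1` modulo `4` on the part of `u` and labels `≡ 2, 4` modulo `8` on
the other part. The latter are enumerated increasingly by `p ↦ 4p + 2 - 2(p mod 2)`, and the
vertices of `R` get those with index in `[a, b)`. -/
lemma exists_isOddGracefulColoring_mod_eight {s a b : ℕ} {z : ℤ} {u : Fin (2 * s + 1)}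
    {R : Finset (Fin (2 * s))} (hb : b ≤ 2 * s) (hR : b - a ≤ R.card)
    (hz : 1 ≤ z ∧ z ≤ 8 * s - 3 ∧ z % 4 = 3)
    (h₁ : ∀ p i : ℕ, p < 2 * s → i < 2 * s → p < a ∨ b ≤ p →
      4 * (i : ℤ) + 1 + z ≠ 2 * (4 * p + 2 - 2 * (p % 2)))
    (h₂ : ∀ p q : ℕ, p < 2 * s → q < 2 * s → p ≠ q → p < a ∨ b ≤ p → q < a ∨ b ≤ q →
      4 * (p : ℤ) + 2 - 2 * (p % 2) + (4 * q + 2 - 2 * (q % 2)) ≠ 2 * z) :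
    ∃ c : Fin (2 * s + 1) ⊕ Fin (2 * s) → ℤ,
      IsOddGracefulColoring (nearCompleteBipartite u R) (8 * s - 3) c := by
  have hk : ((8 * s - 3 : ℕ) : ℤ) = 8 * s - 3 := by omega
  have hg : Function.Injective (fun p : ℕ => 4 * (p : ℤ) + 2 - 2 * (p % 2)) := by
    intro p q hpq
    simp only at hpq
    omega
  have hC : ∀ x ∈ (range (2 * s)).image (fun i : ℕ => 4 * (i : ℤ) + 1),
      1 ≤ x ∧ x ≤ 8 * s - 3 ∧ x % 4 = 1 := by
    intro x hx
    obtain ⟨i, hi, rfl⟩ := mem_image.1 hx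
    have := mem_range.1 hi
    omega
  have hD : ∀ d ∈ (range (2 * s)).image (fun p : ℕ => 4 * (p : ℤ) + 2 - 2 * (p % 2)),
      1 ≤ d ∧ d ≤ 8 * s - 3 ∧ (d % 8 = 2 ∨ d % 8 = 4) := by
    intro d hd
    obtain ⟨p, hp, rfl⟩ := mem_image.1 hd
    have := mem_range.1 hp
    omega
  have hDF : ∀ p ∉ Ico a b, p < a ∨ b ≤ p := by
    intro p hp
    rw [mem_Ico] at hp
    omega
  refine exists_isOddGracefulColoring
    (C := (range (2 * s)).image (fun i : ℕ => 4 * (i : ℤ) + 1))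
    (D := (range (2 * s)).image (fun p : ℕ => 4 * (p : ℤ) + 2 - 2 * (p % 2)))
    (F := (Ico a b).image (fun p : ℕ => 4 * (p : ℤ) + 2 - 2 * (p % 2))) (z := z)
    ?_ ?_ ?_ ?_ ?_ ?_ (by omega) ?_ ?_ ?_ ?_ ?_ ?_ ?_
  · rw [card_image_of_injective _ (fun i j hij => by omega), card_range]
  · rw [card_image_of_injective _ hg, card_range]
  · refine image_subset_image fun p hp => ?_
    rw [mem_Ico] at hp
    exact mem_range.2 (by omega)
  · rw [card_image_of_injective _ hg, Nat.card_Ico]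
    exact hR
  · intro x hx
    have := hC x hx
    omega
  · intro d hd
    have := hD d hd
    omega
  · intro h
    have := hC _ h
    omega
  · intro x hx d hd
    have := hC x hx
    have := hD d hd
    omega
  · intro d hd
    have := hD d hd
    omega
  · intro x hx y hy hxy d hd
    have := hC x hx
    have := hC y hy
    have := hD d hd
    omega
  · intro d hd e he hde x hx
    obtain ⟨p, hp, rfl⟩ := mem_image.1 hd
    obtain ⟨q, hq, rfl⟩ := mem_image.1 he
    have := hC x hx
    omega
  · intro x hx d hd hdF
    obtain ⟨i, hi, rfl⟩ := mem_image.1 hx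
    obtain ⟨p, hp, rfl⟩ := mem_image.1 hd
    exact h₁ p i (mem_range.1 hp) (mem_range.1 hi) (hDF p fun h => hdF (mem_image_of_mem _ h))
  · intro d hd hdF e he heF hde
    obtain ⟨p, hp, rfl⟩ := mem_image.1 hd
    obtain ⟨q, hq, rfl⟩ := mem_image.1 he
    exact h₂ p q (mem_range.1 hp) (mem_range.1 hq) (fun h => hde (by rw [h]))
      (hDF p fun h => hdF (mem_image_of_mem _ h)) (hDF q fun h => heF (mem_image_of_mem _ h))

lemma exists_isOddGracefulColoring_of_le_card {s : ℕ} {u : Fin (2 * s + 1)}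
    {R : Finset (Fin (2 * s))} (hs : 2 ≤ s) (hR : s ≤ R.card) :
    ∃ c : Fin (2 * s + 1) ⊕ Fin (2 * s) → ℤ,
      IsOddGracefulColoring (nearCompleteBipartite u R) (8 * s - 3) c := by
  -- in both cases exactly `s` labels of the second part are midpoints of `z` and a label `≡ 1`
  rcases Nat.even_or_odd s with h | h
  · rw [Nat.even_iff] at h
    exact exists_isOddGracefulColoring_mod_eight (a := 0) (b := s) (z := 3) (by omega) (by omega)
      (by omega) (fun p i hp hi hp' => by omega) (fun p q hp hq hpq hp' hq' => by omega)
  · rw [Nat.odd_iff] at h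
    exact exists_isOddGracefulColoring_mod_eight (a := 1) (b := s + 1) (z := 7) (by omega)
      (by omega) (by omega) (fun p i hp hi hp' => by omega)
      (fun p q hp hq hpq hp' hq' => by omega)

lemma exists_isOddGracefulColoring_of_odd {s : ℕ} {u : Fin (2 * s + 1)}
    {R : Finset (Fin (2 * s))} (hs : 5 ≤ s) (h : Odd s) (hR : s - 1 ≤ R.card) :
    ∃ c : Fin (2 * s + 1) ⊕ Fin (2 * s) → ℤ,
      IsOddGracefulColoring (nearCompleteBipartite u R) (8 * s - 3) c := by
  rw [Nat.odd_iff] at h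
  -- for `z ≡ 11` modulo `16` only `s - 1` labels of the second part are midpoints of `z` and a
  -- label `≡ 1`
  exact exists_isOddGracefulColoring_mod_eight (a := 2) (b := s + 1) (z := 11) (by omega)
    (by omega) (by omega) (fun p i hp hi hp' => by omega)
    (fun p q hp hq hpq hp' hq' => by omega)

end Graph

/-! ### Constraints on the label of the distinguished vertex -/

/-- The constraints that an odd graceful coloring puts on the labels `f` of the part of `u` and
`g` of the other part, when both `u` and some other vertex of its part have neighbours. -/
structure IsLabeling {m n : ℕ} (u : Fin m) (R : Finset (Fin n)) (k : ℕ) (f : Fin m → ℤ)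
    (g : Fin n → ℤ) : Prop where
  f_mem : ∀ x, 1 ≤ f x ∧ f x ≤ k
  g_mem : ∀ w, 1 ≤ g w ∧ g w ≤ k
  f_inj : Function.Injective f
  g_inj : Function.Injective g
  parity : ∀ x w, (f x + g w) % 2 = 1
  f_mid : ∀ x y w, x ≠ u → y ≠ u → x ≠ y → f x + f y ≠ 2 * g w
  g_mid : ∀ w v x, x ≠ u → w ≠ v → g w + g v ≠ 2 * f x
  u_mid : ∀ x w, x ≠ u → f x + f u = 2 * g w → w ∈ R
  mid_u : ∀ w v, w ≠ v → g w + g v = 2 * f u → w ∈ R ∨ v ∈ R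

section Graph

variable {m n : ℕ} {u : Fin m} {R : Finset (Fin n)}

lemma IsOddGracefulColoring.isLabeling {k : ℕ} {c : Fin m ⊕ Fin n → ℤ} (hm : 2 ≤ m)
    (hR : R.card < n) (hc : IsOddGracefulColoring (nearCompleteBipartite u R) k c) :
    IsLabeling u R k (fun x => c (Sum.inl x)) (fun w => c (Sum.inr w)) := by
  obtain ⟨x₀, hx₀⟩ : ∃ x₀ : Fin m, x₀ ≠ u := by
    have : Nontrivial (Fin m) := Fin.nontrivial_iff_two_le.2 hm
    exact exists_ne u
  obtain ⟨w₀, hw₀⟩ : ∃ w₀ : Fin n, w₀ ∉ R := by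
    by_contra! h
    have := card_le_card (fun w _ => h w : (univ : Finset (Fin n)) ⊆ R)
    rw [card_univ, Fintype.card_fin] at this
    omega
  have hleft : ∀ x y w, x ≠ y → (x = u → w ∉ R) → (y = u → w ∉ R) →
      c (Sum.inl x) ≠ c (Sum.inl y) ∧ c (Sum.inl x) + c (Sum.inl y) ≠ 2 * c (Sum.inr w) := by
    intro x y w hxy hx hy
    rw [← edgeLabel_ne_iff]
    exact hc.edge_proper _ _ _ (nearCompleteBipartite_adj_inr_inl.2 hx)
      (nearCompleteBipartite_adj_inr_inl.2 hy) (by simpa using hxy)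
  have hright : ∀ w v x, w ≠ v → (x = u → w ∉ R) → (x = u → v ∉ R) →
      c (Sum.inr w) ≠ c (Sum.inr v) ∧ c (Sum.inr w) + c (Sum.inr v) ≠ 2 * c (Sum.inl x) := by
    intro w v x hwv hw hv
    rw [← edgeLabel_ne_iff]
    exact hc.edge_proper _ _ _ (nearCompleteBipartite_adj_inl_inr.2 hw)
      (nearCompleteBipartite_adj_inl_inr.2 hv) (by simpa using hwv)
  have hpar : ∀ x w, (x = u → w ∉ R) → (c (Sum.inl x) + c (Sum.inr w)) % 2 = 1 := by
    intro x w h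
    have := hc.odd_edge _ _ (nearCompleteBipartite_adj_inl_inr.2 h)
    rw [edgeLabel, odd_abs, Int.odd_iff] at this
    omega
  refine ⟨fun x => hc.mem_Icc _, fun w => hc.mem_Icc _, ?_, ?_, ?_, ?_, ?_, ?_, ?_⟩
  · intro x y h
    by_contra hxy
    exact (hleft x y w₀ hxy (fun _ => hw₀) (fun _ => hw₀)).1 h
  · intro w v h
    by_contra hwv
    exact (hright w v x₀ hwv (fun h => absurd h hx₀) (fun h => absurd h hx₀)).1 h
  · intro x w
    have h1 := hpar x w₀ (fun _ => hw₀)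
    have h2 := hpar x₀ w₀ (fun _ => hw₀)
    have h3 := hpar x₀ w (fun h => absurd h hx₀)
    omega
  · exact fun x y w hx hy hxy =>
      (hleft x y w hxy (fun h => absurd h hx) (fun h => absurd h hy)).2
  · exact fun w v x hx hwv => (hright w v x hwv (fun h => absurd h hx) (fun h => absurd h hx)).2
  · intro x w hx h
    by_contra hw
    exact (hleft x u w hx (fun _ => hw) (fun _ => hw)).2 h
  · intro w v hwv h
    by_contra! hR
    exact (hright w v u hwv (fun _ => hR.1) (fun _ => hR.2)).2 h

/-- An injective family of labels carried by vertices of `R` bounds the size of `R` from below. -/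
lemma le_card_of_labels {g : Fin n → ℤ} {t : ℕ} (l : ℕ → ℤ)
    (hl : ∀ i j, i < t → j < t → l i = l j → i = j) (h : ∀ i < t, ∃ w ∈ R, g w = l i) :
    t ≤ R.card := by
  have hcard : ((range t).image l).card = t := by
    rw [card_image_of_injOn, card_range]
    intro i hi j hj hij
    exact hl i j (by simpa using hi) (by simpa using hj) hij
  calc t = ((range t).image l).card := hcard.symm
    _ ≤ (R.image g).card := by
      refine card_le_card fun y hy => ?_
      obtain ⟨i, hi, rfl⟩ := mem_image.1 hy
      obtain ⟨w, hw, hwi⟩ := h i (mem_range.1 hi)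
      exact mem_image.2 ⟨w, hw, hwi⟩
    _ ≤ R.card := card_image_le

variable {k : ℕ} {f : Fin m → ℤ} {g : Fin n → ℤ}

lemma IsLabeling.ne_of_ne (h : IsLabeling u R k f g) {x : Fin m} (hx : x ≠ u) : f x ≠ f u :=
  fun h' => hx (h.f_inj h')

/-- If the labels of the part of `u` other than that of `u` are `1` and `k = 2n + 1`, and the
other part has all even labels, then at least two vertices lie in `R`. -/
lemma IsLabeling.two_le_card (h : IsLabeling u R k f g) (hn : 2 ≤ n) (hn2 : n % 2 = 0)
    (hk : k ≤ 2 * n + 1)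
    (hC : ∀ y, (∃ x, x ≠ u ∧ f x = y) ↔ y = 1 ∨ y = 2 * n + 1)
    (hD : ∀ y, (∃ w, g w = y) ↔ 1 ≤ y ∧ y ≤ 2 * n + 1 ∧ y % 2 = 0) : 2 ≤ R.card := by
  obtain ⟨x₁, hx₁, hx₁'⟩ := (hC 1).2 (Or.inl rfl)
  obtain ⟨x₂, hx₂, hx₂'⟩ := (hC (2 * n + 1)).2 (Or.inr rfl)
  have hz1 := h.ne_of_ne hx₁
  have hz2 := h.ne_of_ne hx₂
  have hzk := h.f_mem u
  obtain ⟨w₂, hw₂⟩ := (hD 2).2 (by omega)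
  have hpar := h.parity u w₂
  have hinR : ∀ (x : Fin m) (y : ℤ), x ≠ u → 1 ≤ y → y ≤ 2 * n + 1 → y % 2 = 0 →
      f x + f u = 2 * y →
      ∃ w ∈ R, g w = y := by
    intro x y hx h1 h2 h3 hy
    obtain ⟨w, hw⟩ := (hD y).2 ⟨h1, h2, h3⟩
    exact ⟨w, h.u_mid x w hx (by rw [hw, hy]), hw⟩
  have hpair : ∀ y, 1 ≤ y → y < f u → 2 * f u - y ≤ 2 * n + 1 → y % 2 = 0 →
      ∃ w ∈ R, g w = y ∨ g w = 2 * f u - y := by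
    intro y h1 h2 h3 h4
    obtain ⟨w, hw⟩ := (hD y).2 (by omega)
    obtain ⟨v, hv⟩ := (hD (2 * f u - y)).2 (by omega)
    have hwv : w ≠ v := by
      rintro rfl
      omega
    rcases h.mid_u w v hwv (by omega) with hR | hR
    · exact ⟨w, hR, Or.inl hw⟩
    · exact ⟨v, hR, Or.inr hv⟩
  rcases (by omega : f u % 4 = 3 ∨ f u % 4 = 1) with h4 | h4
  · -- the midpoints of `f u` with the two extreme labels are labels of `R`
    obtain ⟨a, ha, ha'⟩ := hinR x₁ ((f u + 1) / 2) hx₁ (by omega) (by omega) (by omega) (by omega)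
    obtain ⟨b, hb, hb'⟩ := hinR x₂ ((f u + (2 * n + 1)) / 2) hx₂ (by omega) (by omega) (by omega)
      (by omega)
    refine one_lt_card.2 ⟨a, ha, b, hb, ?_⟩
    rintro rfl
    omega
  · -- two pairs of labels are symmetric about `f u`
    obtain ⟨a, ha, ha'⟩ := hpair (f u - 1) (by omega) (by omega) (by omega) (by omega)
    obtain ⟨b, hb, hb'⟩ := hpair (f u - 3) (by omega) (by omega) (by omega) (by omega)
    refine one_lt_card.2 ⟨a, ha, b, hb, ?_⟩
    rintro rfl
    omega

/-- The case in which the part of `u` has the labels `≡ 2, 4` modulo `8` and the other part those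
`≡ 1` modulo `4`: every label of one of the two former classes has its midpoint with `f u` among
the labels of `R`. -/
lemma IsLabeling.le_card_of_even (h : IsLabeling u R k f g) {s : ℕ} (hs : 1 ≤ s)
    (hk : k ≤ 8 * s - 3)
    (hC : ∀ y, (∃ x, x ≠ u ∧ f x = y) ↔ 1 ≤ y ∧ y ≤ 8 * s - 3 ∧ (y % 8 = 2 ∨ y % 8 = 4))
    (hD : ∀ y, (∃ w, g w = y) ↔ 1 ≤ y ∧ y ≤ 8 * s - 3 ∧ y % 4 = 1) :
    2 ≤ s ∧ s ≤ R.card := by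
  have hzk := h.f_mem u
  have hzC : ¬ (f u % 8 = 2 ∨ f u % 8 = 4) := by
    intro h'
    obtain ⟨x, hx, hxu⟩ := (hC (f u)).2 (by omega)
    exact h.ne_of_ne hx hxu
  obtain ⟨w₁, hw₁⟩ := (hD 1).2 (by omega)
  have hpar := h.parity u w₁
  refine ⟨by omega, ?_⟩
  have hinR : ∀ y : ℤ, 1 ≤ y → y ≤ 8 * s - 3 → (y % 8 = 2 ∨ y % 8 = 4) → (y + f u) % 8 = 2 →
      ∃ w ∈ R, g w = (y + f u) / 2 := by
    intro y h1 h2 h3 h4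
    obtain ⟨x, hx, hxy⟩ := (hC y).2 ⟨h1, h2, h3⟩
    obtain ⟨w, hw⟩ := (hD ((y + f u) / 2)).2 (by omega)
    exact ⟨w, h.u_mid x w hx (by omega), hw⟩
  rcases (by omega : f u % 8 = 6 ∨ f u % 8 = 0) with h8 | h8
  · exact le_card_of_labels (fun i => (4 + 8 * (i : ℤ) + f u) / 2)
      (fun i j _ _ hij => by omega)
      (fun i hi => hinR _ (by omega) (by omega) (by omega) (by omega))
  · exact le_card_of_labels (fun i => (2 + 8 * (i : ℤ) + f u) / 2)
      (fun i j _ _ hij => by omega)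
      (fun i hi => hinR _ (by omega) (by omega) (by omega) (by omega))

/-- The case in which the part of `u` has the labels `≡ 1` modulo `4` and the other part those
`≡ 2, 4` modulo `8`. With `f u = 4j - 1`, the labels of the second part in `[2j, 2j + 4s - 2]` are
labels of `R`. This window of `2s` even numbers contains at least `s` labels, unless `s` is odd
and `j ≡ 3` modulo `4`, when it contains `s - 1`. -/
lemma IsLabeling.le_card_of_odd (h : IsLabeling u R k f g) {s : ℕ} (hs : 1 ≤ s)
    (hk : k ≤ 8 * s - 3)
    (hC : ∀ y, (∃ x, x ≠ u ∧ f x = y) ↔ 1 ≤ y ∧ y ≤ 8 * s - 3 ∧ y % 4 = 1)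
    (hD : ∀ y, (∃ w, g w = y) ↔ 1 ≤ y ∧ y ≤ 8 * s - 3 ∧ (y % 8 = 2 ∨ y % 8 = 4)) :
    (2 ≤ s ∧ s ≤ R.card) ∨ (s = 1 ∧ 2 ≤ R.card) ∨ (5 ≤ s ∧ s % 2 = 1 ∧ s - 1 ≤ R.card) := by
  have hzk := h.f_mem u
  have hzC : f u % 4 ≠ 1 := by
    intro h'
    obtain ⟨x, hx, hxu⟩ := (hC (f u)).2 (by omega)
    exact h.ne_of_ne hx hxu
  obtain ⟨w₂, hw₂⟩ := (hD 2).2 (by omega)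
  have hpar := h.parity u w₂
  obtain ⟨j, hj⟩ : ∃ j : ℕ, f u = 4 * j - 1 := ⟨((f u + 1) / 4).toNat, by omega⟩
  have hinR : ∀ y : ℤ, 2 * j ≤ y → y ≤ 2 * j + 4 * s - 2 → y ≤ 8 * s - 3 →
      (y % 8 = 2 ∨ y % 8 = 4) → ∃ w ∈ R, g w = y := by
    intro y h1 h2 h3 h4
    obtain ⟨x, hx, hxy⟩ := (hC (2 * y - f u)).2 (by omega)
    obtain ⟨w, hw⟩ := (hD y).2 (by omega)
    exact ⟨w, h.u_mid x w hx (by omega), hw⟩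
  -- `p ↦ 4p + 2 - 2(p mod 2)` enumerates the labels of the second part; `p₀` is the index of the
  -- first one in the window
  by_cases hcase : s % 2 = 1 ∧ j % 4 = 3
  · have hcard : s - 1 ≤ R.card := by
      refine le_card_of_labels
        (fun i => 4 * (((j + 1) / 2 + i : ℕ) : ℤ) + 2 - 2 * ((((j + 1) / 2 + i) % 2 : ℕ) : ℤ))
        (fun i j _ _ hij => by omega)
        (fun i hi => hinR _ (by omega) (by omega) (by omega) (by omega))
    by_cases hs5 : 5 ≤ s
    · exact Or.inr (Or.inr ⟨hs5, hcase.1, hcard⟩)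
    · -- here `f u = 11`; besides `10` and `12`, one of the labels `2` and `20` belongs to `R`
      obtain rfl : s = 3 := by omega
      obtain rfl : j = 3 := by omega
      obtain ⟨a, ha, ha'⟩ := hinR 10 (by omega) (by omega) (by omega) (by omega)
      obtain ⟨b, hb, hb'⟩ := hinR 12 (by omega) (by omega) (by omega) (by omega)
      obtain ⟨v, hv⟩ := (hD 20).2 (by omega)
      have hwv : w₂ ≠ v := by
        rintro rfl
        omega
      have : 3 ≤ R.card := by
        have hd : ∃ d ∈ R, g d = 2 ∨ g d = 20 := by
          rcases h.mid_u w₂ v hwv (by omega) with h' | h'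
          · exact ⟨_, h', Or.inl hw₂⟩
          · exact ⟨_, h', Or.inr hv⟩
        obtain ⟨d, hd, hd'⟩ := hd
        refine two_lt_card.2 ⟨a, ha, b, hb, d, hd, ?_, ?_, ?_⟩ <;>
        · rintro rfl
          omega
      omega
  · have hcard : s ≤ R.card := by
      by_cases hj3 : j % 4 = 3
      · refine le_card_of_labels
          (fun i => 4 * (((j + 1) / 2 + i : ℕ) : ℤ) + 2 - 2 * ((((j + 1) / 2 + i) % 2 : ℕ) : ℤ))
          (fun i j _ _ hij => by omega)
          (fun i hi => hinR _ (by omega) (by omega) (by omega) (by omega))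
      · refine le_card_of_labels
          (fun i => 4 * ((j / 2 + i : ℕ) : ℤ) + 2 - 2 * (((j / 2 + i) % 2 : ℕ) : ℤ))
          (fun i j _ _ hij => by omega)
          (fun i hi => hinR _ (by omega) (by omega) (by omega) (by omega))
    by_cases hs1 : s = 1
    · subst hs1
      obtain rfl : j = 1 := by omega
      obtain ⟨a, ha, ha'⟩ := hinR 2 (by omega) (by omega) (by omega) (by omega)
      obtain ⟨b, hb, hb'⟩ := hinR 4 (by omega) (by omega) (by omega) (by omega)
      refine Or.inr (Or.inl ⟨rfl, one_lt_card.2 ⟨a, ha, b, hb, ?_⟩⟩)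
      rintro rfl
      omega
    · exact Or.inl ⟨by omega, hcard⟩

/-- No labeling has its labels in `[1, k]` with `k < 2m + 2n - 5`, and one with `k = 2m + 2n - 5`
exists only in the exceptional families. -/
theorem IsLabeling.inExceptionalFamily (h : IsLabeling u R k f g) (hm : 2 ≤ m) (hn : 2 ≤ n)
    (hRn : R.card < n) (hk : k ≤ 2 * m + 2 * n - 5) :
    k = 2 * m + 2 * n - 5 ∧ InExceptionalFamily m n R.card := by
  set C : Finset ℤ := (univ.erase u).image f with hCdef
  set D : Finset ℤ := univ.image g with hDdef
  have memC : ∀ y, y ∈ C ↔ ∃ x, x ≠ u ∧ f x = y := by simp [hCdef]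
  have memD : ∀ y, y ∈ D ↔ ∃ w, g w = y := by simp [hDdef]
  have cardC : C.card = m - 1 := by
    rw [hCdef, card_image_of_injective _ h.f_inj, card_erase_of_mem (mem_univ u), card_univ,
      Fintype.card_fin]
  have cardD : D.card = n := by
    rw [hDdef, card_image_of_injective _ h.g_inj, card_univ, Fintype.card_fin]
  have hCmid : ∀ a ∈ C, ∀ b ∈ C, a ≠ b → ∀ d ∈ D, a + b ≠ 2 * d := by
    intro a ha b hb hab d hd
    obtain ⟨x, hx, rfl⟩ := (memC a).1 ha
    obtain ⟨y, hy, rfl⟩ := (memC b).1 hb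
    obtain ⟨w, rfl⟩ := (memD d).1 hd
    exact h.f_mid x y w hx hy (fun h' => hab (by rw [h']))
  have hDmid : ∀ a ∈ D, ∀ b ∈ D, a ≠ b → ∀ d ∈ C, a + b ≠ 2 * d := by
    intro a ha b hb hab d hd
    obtain ⟨w, rfl⟩ := (memD a).1 ha
    obtain ⟨v, rfl⟩ := (memD b).1 hb
    obtain ⟨x, hx, rfl⟩ := (memC d).1 hd
    exact h.g_mid w v x hx (fun h' => hab (by rw [h']))
  have hw₀ : 0 < n := by omega
  have hparC : ∀ x, (f x + f u) % 2 = 0 := by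
    intro x
    have h1 := h.parity x ⟨0, hw₀⟩
    have h2 := h.parity u ⟨0, hw₀⟩
    omega
  have hkL : (k : ℤ) ≤ 2 * (m + n - 2 : ℕ) - 1 := by omega
  have hmax : ∀ y, (y ∈ C ∨ y ∈ D) → y ≤ k := by
    rintro y (hy | hy)
    · obtain ⟨x, -, rfl⟩ := (memC y).1 hy
      exact (h.f_mem x).2
    · obtain ⟨w, rfl⟩ := (memD y).1 hy
      exact (h.g_mem w).2
  rcases Int.emod_two_eq_zero_or_one (f u) with hu | hu
  · have hCE : ∀ x ∈ C, 1 ≤ x ∧ x ≤ 2 * (m + n - 2 : ℕ) - 1 ∧ x % 2 = 0 := by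
      intro y hy
      obtain ⟨x, hx, rfl⟩ := (memC y).1 hy
      have := h.f_mem x
      have := hparC x
      omega
    have hDO : ∀ x ∈ D, 1 ≤ x ∧ x ≤ 2 * (m + n - 2 : ℕ) - 1 ∧ x % 2 = 1 := by
      intro y hy
      obtain ⟨w, rfl⟩ := (memD y).1 hy
      have := h.g_mem w
      have := h.parity u w
      omega
    rcases label_sets_classification (by omega) hDO hCE (by omega) hDmid hCmid with
      ⟨hL2, hD2, hDiff, hCiff⟩ | ⟨s, hs, hL, hDs, hDiff, hCiff⟩
    · -- the even label of `u` would be one of the other even labels, all of which are used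
      obtain ⟨x, hx, hxu⟩ := (memC (f u)).1 ((hCiff (f u)).2 (by
        have := h.f_mem u
        omega))
      exact absurd hxu (h.ne_of_ne hx)
    · have hkm := hmax (8 * s - 3) (Or.inr ((hDiff _).2 (by omega)))
      have := h.le_card_of_even hs (by omega) (fun y => by rw [← memC, hCiff])
        (fun y => by rw [← memD, hDiff])
      exact ⟨by omega, Or.inr (Or.inl ⟨s, by omega, by omega, by omega, by omega, by omega⟩)⟩
  · have hCO : ∀ x ∈ C, 1 ≤ x ∧ x ≤ 2 * (m + n - 2 : ℕ) - 1 ∧ x % 2 = 1 := by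
      intro y hy
      obtain ⟨x, hx, rfl⟩ := (memC y).1 hy
      have := h.f_mem x
      have := hparC x
      omega
    have hDE : ∀ x ∈ D, 1 ≤ x ∧ x ≤ 2 * (m + n - 2 : ℕ) - 1 ∧ x % 2 = 0 := by
      intro y hy
      obtain ⟨w, rfl⟩ := (memD y).1 hy
      have := h.g_mem w
      have := h.parity u w
      omega
    rcases label_sets_classification (by omega) hCO hDE (by omega) hCmid hDmid with
      ⟨hL2, hC2, hCiff, hDiff⟩ | ⟨s, hs, hL, hCs, hCiff, hDiff⟩
    · have hkm := hmax (2 * (m + n - 2 : ℕ) - 1) (Or.inl ((hCiff _).2 (Or.inr rfl)))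
      have hcast : (2 * (m + n - 2 : ℕ) - 1 : ℤ) = 2 * n + 1 := by omega
      rw [hcast] at hCiff hDiff
      have := h.two_le_card hn (by omega) (by omega) (fun y => by rw [← memC, hCiff])
        (fun y => by rw [← memD, hDiff])
      exact ⟨by omega, Or.inl ⟨n / 2, by omega, by omega, by omega, by omega, by omega⟩⟩
    · have hkm := hmax (8 * s - 3) (Or.inl ((hCiff _).2 (by omega)))
      have hcases := h.le_card_of_odd hs (by omega) (fun y => by rw [← memC, hCiff])
        (fun y => by rw [← memD, hDiff])
      refine ⟨by omega, ?_⟩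
      rcases hcases with ⟨h1, h2⟩ | ⟨h1, h2⟩ | ⟨h1, h2, h3⟩
      · exact Or.inr (Or.inl ⟨s, h1, by omega, by omega, h2, by omega⟩)
      · exact Or.inl ⟨s, hs, by omega, by omega, h2, by omega⟩
      · rcases h3.eq_or_lt with h3 | h3
        · exact Or.inr (Or.inr ⟨s, h1, Nat.odd_iff.2 h2, by omega, by omega, h3.symm⟩)
        · exact Or.inr (Or.inl ⟨s, by omega, by omega, by omega, by omega, by omega⟩)

end Graph

/-! ### The odd graceful chromatic number -/

theorem theorem2p11 (m n r : ℕ) (hm : 2 ≤ m) (hn : 2 ≤ n) (hr : 1 ≤ r) (hrn : r ≤ n - 1)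
    (u : Fin m) (R : Finset (Fin n)) (hR : R.card = r) :
    (InExceptionalFamily m n r →
      oddGracefulChromaticNumber (nearCompleteBipartite u R) = ((2 * m + 2 * n - 5 : ℕ) : ℕ∞)) ∧
    (¬ InExceptionalFamily m n r →
      oddGracefulChromaticNumber (nearCompleteBipartite u R) = ((2 * m + 2 * n - 4 : ℕ) : ℕ∞)) := by
  subst hR
  have hlower : ∀ (j : ℕ) (c : Fin m ⊕ Fin n → ℤ),
      IsOddGracefulColoring (nearCompleteBipartite u R) j c → j ≤ 2 * m + 2 * n - 5 →
      j = 2 * m + 2 * n - 5 ∧ InExceptionalFamily m n R.card := fun j c hc hj =>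
    (hc.isLabeling hm (by omega)).inExceptionalFamily hm hn (by omega) hj
  constructor
  · intro hexc
    refine oddGracefulChromaticNumber_eq (by omega) ?_ fun j c hc => ?_
    · rcases hexc with ⟨s, hs, rfl, rfl, h1, h2⟩ | ⟨s, hs, rfl, rfl, h1, h2⟩ |
        ⟨s, hs, hodd, rfl, rfl, h1⟩
      · convert exists_isOddGracefulColoring_three (u := u) (R := R) (by omega) h1 using 3
        omega
      · convert exists_isOddGracefulColoring_of_le_card (u := u) (R := R) hs h1 using 3
        omega
      · convert exists_isOddGracefulColoring_of_odd (u := u) (R := R) hs hodd h1.ge using 3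
        omega
    · by_contra! hlt
      have := (hlower j c hc (by omega)).1
      omega
  · intro hexc
    refine oddGracefulChromaticNumber_eq (by omega)
      (exists_isOddGracefulColoring_of_one_le hm hn hr) fun j c hc => ?_
    by_contra! hlt
    exact hexc (hlower j c hc (by omega)).2
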